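/- A consumer faces one product $j$ and a fallback action. The fallback yields $\bar u\in\mathbb R$, ends the search and stays available until the search ends. The purchase value $u_{ij}$ of the product is a real random variable with known distribution $F^u_{ij}$ and finite mean; its realization is revealed only by inspecting the product, at cost $c_{ij}>0$, after which the consumer either purchases the product and receives $u_{ij}$, or takes the fallback. So the available actions are the fallback and inspection before inspection, and the fallback and purchase after it. A policy is optimal if it maximizes the expected payoff from every stage (before inspection, and after inspection for each revealed value). The equation $$c_{ij}=\int_{u>z}(u-z)\,dF^u_{ij}(u)$$ has exactly one solution $z=z_{ij}\in\mathbb R$, the reservation value of the product. Put $w_{ij}:=\min\{z_{ij},u_{ij}\}$, the effective value of the product. A Gittins index policy selects at every stage an available action of highest index, the indices being $\bar u$ for the fallback, $z_{ij}$ for inspection and $u_{ij}$ for purchase. Then, for every $\bar u$: 1. the optimal policies are exactly the Gittins index policies; 2. under every optimal policy and for every realization $u_{ij}$ with $\bar u\ne w_{ij}$, the fallback is selected (whether without or after inspection of the product, which need not be identified) if and only if $\bar u>w_{ij}$; 3. there are optimal policies that resolve ties in favour of the product (the fallback is selected only at stages where $\bar u$ strictly exceeds the index of the other available action), and under each of them,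 for every realization $u_{ij}$ without exception, the fallback is selected if and only if $\bar u>w_{ij}$. -/

import Mathlib

open MeasureTheory

namespace Search

/-- The actions of the problem with one product and a fallback: take the fallback, inspect the
product, or purchase the product at the purchase value `u` revealed by its inspection. -/
inductive Act where
  | fallback : Act
  | inspect : Act
  | purchase (u : ℝ) : Act

/-- The decision stages: the product has not been inspected yet, or it has been inspected and
its purchase value turned out to be `u`. -/
inductive Stage where
  | uninspected : Stage
  | inspected (u : ℝ) : Stage

/-- The actions available at each stage. The fallback is never withdrawn; an inspection replaces
the action of inspecting by the action of purchasing. -/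
def available : Stage → Set Act
  | .uninspected => {Act.fallback, Act.inspect}
  | .inspected u => {Act.fallback, Act.purchase u}

/-- A policy selects an available action at every stage, measurably in the revealed value. -/
structure Policy where
  choice : Stage → Act
  choice_mem : ∀ s, choice s ∈ available s
  measurableSet_purchase : MeasurableSet {u : ℝ | choice (.inspected u) = Act.purchase u}

/-- The action with which the search ends when the realized purchase value is `u`: the first
selected action, unless this is the inspection, in which case it is the action selected next. -/
def Policy.finalAct (π : Policy) (u : ℝ) : Act :=
  match π.choice .uninspected with
  | .inspect => π.choice (.inspected u)
  | a => a

/-- The fallback is selected (with or without a previous inspection of the product) when the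
realized purchase value is `u`. -/
def Policy.SelectsFallback (π : Policy) (u : ℝ) : Prop :=
  π.finalAct u = Act.fallback

/-- Payoff of a policy after an inspection that revealed `u`; `ubar` is the fallback value. -/
def Policy.payoffInspected (ubar : ℝ) (π : Policy) (u : ℝ) : ℝ :=
  match π.choice (.inspected u) with
  | .purchase v => v
  | _ => ubar

/-- Expected payoff of a policy from each stage on; `μ` is the law of the purchase value, `c` the
inspection cost, `ubar` the fallback value. -/
noncomputable def Policy.value (μ : Measure ℝ) (c ubar : ℝ) (π : Policy) : Stage → ℝ
  | .inspected u => π.payoffInspected ubar u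
  | .uninspected =>
    match π.choice .uninspected with
    | .inspect => -c + ∫ u, π.payoffInspected ubar u ∂μ
    | _ => ubar

/-- A policy is optimal if from every stage on its expected payoff is the largest possible. -/
def IsOptimal (μ : Measure ℝ) (c ubar : ℝ) (π : Policy) : Prop :=
  ∀ (s : Stage) (π' : Policy), π'.value μ c ubar s ≤ π.value μ c ubar s

/-- `z` is a reservation value of the product: at the fallback value `z` the inspection cost
equals the expected gain from inspection. -/
def IsReservationValue (μ : Measure ℝ) (c z : ℝ) : Prop :=
  c = ∫ u in Set.Ioi z, (u - z) ∂μ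

/-- The index of an action: the fallback value, the reservation value `z` for inspecting, the
purchase value for purchasing. -/
def gittinsIndex (ubar z : ℝ) : Act → ℝ
  | .fallback => ubar
  | .inspect => z
  | .purchase u => u

/-- The Gittins index policy, with any resolution of ties: an available action of highest index
is selected at every stage. -/
def IsGittins (ubar z : ℝ) (π : Policy) : Prop :=
  ∀ s, ∀ a ∈ available s, gittinsIndex ubar z a ≤ gittinsIndex ubar z (π.choice s)

/-- Ties are resolved in favour of the product: the fallback is selected only at stages where its
index strictly exceeds the index of the other available action. -/
def FavorsProduct (ubar z : ℝ) (π : Policy) : Prop :=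
  ∀ s, π.choice s = Act.fallback →
    ∀ a ∈ available s, a ≠ Act.fallback → gittinsIndex ubar z a < ubar

/-- The effective value of a product with reservation value `z` and purchase value `u`. -/
def effectiveValue (z u : ℝ) : ℝ := min z u

end Search

/-! Let G(x) = E max(u - x, 0), which is `expectedGain`. After inspection the best payoff is
max(ubar, u), with mean ubar + G(ubar) (`integral_max_eq`). Before it, inspecting is thus worth ubar
+ G(ubar) - c against ubar, so the comparison is between G(ubar) and c = G(z). G is antitone, and
strictly so where positive (`expectedGain_lt_of_lt`), which turns this into comparing ubar with z.
Existence of z is the intermediate value theorem. The fallback ends the search if it beats z before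
inspection or u after it; up to ties, this says that it exceeds min(z, u). -/

namespace Search

/-! ### The expected gain as a function of the fallback value -/

section ExpectedGain

variable {μ : Measure ℝ}

/-- The expected gain from inspection when the fallback value is `x`. -/
noncomputable def expectedGain (μ : Measure ℝ) (x : ℝ) : ℝ := ∫ u, max (u - x) 0 ∂μ

theorem setIntegral_Ioi_sub_eq_expectedGain (μ : Measure ℝ) (x : ℝ) :
    ∫ u in Set.Ioi x, (u - x) ∂μ = expectedGain μ x := by
  rw [expectedGain, ← integral_indicator measurableSet_Ioi]
  refine integral_congr_ae (Filter.Eventually.of_forall fun u => ?_)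
  by_cases h : x < u
  · simp [Set.indicator, h, h.le]
  · simp [Set.indicator, h, not_lt.1 h]

theorem isReservationValue_iff {c z : ℝ} :
    IsReservationValue μ c z ↔ expectedGain μ z = c := by
  rw [IsReservationValue, setIntegral_Ioi_sub_eq_expectedGain, eq_comm]

variable [IsProbabilityMeasure μ]

theorem integrable_max_sub_zero (hμ : Integrable (fun u : ℝ => u) μ) (x : ℝ) :
    Integrable (fun u : ℝ => max (u - x) 0) μ :=
  (hμ.sub (integrable_const x)).pos_part

theorem expectedGain_antitone (hμ : Integrable (fun u : ℝ => u) μ) :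
    Antitone (expectedGain μ) := fun x y h =>
  integral_mono (integrable_max_sub_zero hμ y) (integrable_max_sub_zero hμ x)
    fun u => max_le_max (by linarith) le_rfl

/-- Ordered integrands with equal integrals agree a.e. Here they differ wherever u > y, so equality
would make the gain at y vanish. Positivity matters: the gain is constantly zero above a bounded
support. -/
theorem expectedGain_lt_of_lt (hμ : Integrable (fun u : ℝ => u) μ) {x y : ℝ} (h : x < y)
    (hy : 0 < expectedGain μ y) : expectedGain μ y < expectedGain μ x := by
  refine lt_of_le_of_ne (expectedGain_antitone hμ h.le) fun heq => hy.ne' ?_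
  have hle : ∀ u : ℝ, max (u - y) 0 ≤ max (u - x) 0 :=
    fun u => max_le_max (by linarith) le_rfl
  have hae := (integral_eq_iff_of_ae_le (integrable_max_sub_zero hμ y)
    (integrable_max_sub_zero hμ x) (Filter.Eventually.of_forall hle)).1 heq
  refine integral_eq_zero_of_ae (hae.mono fun u hu => ?_)
  simp only [Pi.zero_apply] at hu ⊢
  by_contra hne
  have hpos : 0 < u - y := by
    by_contra hn
    exact hne (max_eq_right (not_lt.1 hn))
  rw [max_eq_left hpos.le, max_eq_left (by linarith)] at hu
  linarith

theorem continuous_expectedGain (hμ : Integrable (fun u : ℝ => u) μ) :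
    Continuous (expectedGain μ) := by
  refine continuous_iff_continuousAt.2 fun x => ?_
  refine continuousAt_of_dominated (bound := fun u : ℝ => |u| + (|x| + 1))
    (Filter.Eventually.of_forall fun y => (integrable_max_sub_zero hμ y).aestronglyMeasurable) ?_
    (hμ.abs.add (integrable_const _)) (Filter.Eventually.of_forall fun u => by fun_prop)
  filter_upwards [Metric.ball_mem_nhds x one_pos] with y hy
  refine Filter.Eventually.of_forall fun u => ?_
  rw [Metric.mem_ball, Real.dist_eq] at hy
  have h1 := abs_sub_abs_le_abs_sub y x
  rw [Real.norm_of_nonneg (le_max_right _ _)]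
  refine max_le ?_ (by positivity)
  linarith [le_abs_self u, neg_abs_le y]

theorem tendsto_expectedGain_atTop (hμ : Integrable (fun u : ℝ => u) μ) :
    Filter.Tendsto (expectedGain μ) Filter.atTop (nhds 0) := by
  have key := tendsto_integral_filter_of_dominated_convergence (μ := μ) (l := Filter.atTop)
    (F := fun x u : ℝ => max (u - x) 0) (f := fun _ => 0) (fun u : ℝ => |u|)
    (Filter.Eventually.of_forall fun y => (integrable_max_sub_zero hμ y).aestronglyMeasurable)
    ?_ hμ.abs ?_
  · rwa [integral_zero] at key
  · filter_upwards [Filter.eventually_ge_atTop 0] with x hx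
    refine Filter.Eventually.of_forall fun u => ?_
    rw [Real.norm_of_nonneg (le_max_right _ _)]
    exact max_le (by linarith [le_abs_self u]) (abs_nonneg u)
  · refine Filter.Eventually.of_forall fun u => tendsto_const_nhds.congr' ?_
    filter_upwards [Filter.eventually_ge_atTop u] with x hx
    rw [max_eq_right (by linarith)]

theorem exists_expectedGain_eq (hμ : Integrable (fun u : ℝ => u) μ) {c : ℝ} (hc : 0 < c) :
    ∃ z, expectedGain μ z = c := by
  obtain ⟨b, hb⟩ := ((tendsto_expectedGain_atTop hμ).eventually_lt_const hc).exists
  -- Dropping the positive part gives G(x) ≥ E u - x, which equals c at x = E u - c.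
  have ha : c ≤ expectedGain μ ((∫ u, u ∂μ) - c) := by
    have h := integral_mono (hμ.sub (integrable_const ((∫ u, u ∂μ) - c)))
      (integrable_max_sub_zero hμ ((∫ u, u ∂μ) - c)) fun u => le_max_left _ _
    simp only [Pi.sub_apply] at h
    rw [integral_sub hμ (integrable_const _)] at h
    simpa [expectedGain] using h
  exact mem_range_of_exists_le_of_exists_ge (continuous_expectedGain hμ) ⟨b, hb.le⟩ ⟨_, ha⟩

theorem expectedGain_le_iff (hμ : Integrable (fun u : ℝ => u) μ) {x z : ℝ}
    (hz : 0 < expectedGain μ z) : expectedGain μ x ≤ expectedGain μ z ↔ z ≤ x := by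
  refine ⟨fun h => ?_, fun h => expectedGain_antitone hμ h⟩
  by_contra! hlt
  exact (expectedGain_lt_of_lt hμ hlt hz).not_ge h

theorem le_expectedGain_iff (hμ : Integrable (fun u : ℝ => u) μ) {x z : ℝ}
    (hz : 0 < expectedGain μ z) : expectedGain μ z ≤ expectedGain μ x ↔ x ≤ z := by
  refine ⟨fun h => ?_, fun h => expectedGain_antitone hμ h⟩
  by_contra! hlt
  -- Here the larger argument is x; its gain is positive by `h`.
  exact (expectedGain_lt_of_lt hμ hlt (hz.trans_le h)).not_ge h

theorem integral_max_eq (hμ : Integrable (fun u : ℝ => u) μ) (x : ℝ) :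
    ∫ u, max x u ∂μ = x + expectedGain μ x := by
  have h : (fun u : ℝ => max x u) = fun u => x + max (u - x) 0 := by
    funext u
    rw [← max_add_add_left, add_zero, add_sub_cancel, max_comm]
  rw [h, integral_add (integrable_const x) (integrable_max_sub_zero hμ x)]
  simp [expectedGain]

end ExpectedGain

/-! ### Payoffs of arbitrary policies -/

namespace Policy

variable (π : Policy)

theorem choice_uninspected :
    π.choice .uninspected = .fallback ∨ π.choice .uninspected = .inspect :=
  π.choice_mem .uninspected

theorem choice_inspected (u : ℝ) :
    π.choice (.inspected u) = .fallback ∨ π.choice (.inspected u) = .purchase u :=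
  π.choice_mem (.inspected u)

variable {π}

theorem payoffInspected_of_fallback {ubar u : ℝ} (h : π.choice (.inspected u) = .fallback) :
    π.payoffInspected ubar u = ubar := by simp [payoffInspected, h]

theorem payoffInspected_of_purchase {ubar u : ℝ} (h : π.choice (.inspected u) = .purchase u) :
    π.payoffInspected ubar u = u := by simp [payoffInspected, h]

theorem value_uninspected_of_fallback {μ : Measure ℝ} {c ubar : ℝ}
    (h : π.choice .uninspected = .fallback) : π.value μ c ubar .uninspected = ubar := by
  simp [value, h]

theorem value_uninspected_of_inspect {μ : Measure ℝ} {c ubar : ℝ}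
    (h : π.choice .uninspected = .inspect) :
    π.value μ c ubar .uninspected = -c + ∫ u, π.payoffInspected ubar u ∂μ := by
  simp [value, h]

theorem selectsFallback_iff (u : ℝ) : π.SelectsFallback u ↔
    π.choice .uninspected = .fallback ∨ π.choice (.inspected u) = .fallback := by
  rcases π.choice_uninspected with h | h <;> simp [SelectsFallback, finalAct, h]

theorem payoffInspected_le (π : Policy) (ubar u : ℝ) : π.payoffInspected ubar u ≤ max ubar u := by
  rcases π.choice_inspected u with h | h
  · simp [payoffInspected_of_fallback h]
  · simp [payoffInspected_of_purchase h]

theorem measurable_payoffInspected (π : Policy) (ubar : ℝ) :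
    Measurable (π.payoffInspected ubar) := by
  classical
  have h : π.payoffInspected ubar =
      fun u => if u ∈ {u : ℝ | π.choice (.inspected u) = .purchase u} then u else ubar := by
    funext u
    rcases π.choice_inspected u with h | h
    · simp [payoffInspected_of_fallback h, h]
    · simp [payoffInspected_of_purchase h, h]
  rw [h]
  exact Measurable.ite π.measurableSet_purchase measurable_id measurable_const

theorem integrable_payoffInspected {μ : Measure ℝ} [IsProbabilityMeasure μ]
    (hμ : Integrable (fun u : ℝ => u) μ) (π : Policy) (ubar : ℝ) :
    Integrable (π.payoffInspected ubar) μ := by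
  refine (hμ.abs.add (integrable_const |ubar|)).mono'
    (π.measurable_payoffInspected ubar).aestronglyMeasurable
    (Filter.Eventually.of_forall fun u => ?_)
  rw [Real.norm_eq_abs]
  rcases π.choice_inspected u with h | h
  · simp [payoffInspected_of_fallback h]
  · simp [payoffInspected_of_purchase h]

theorem integral_payoffInspected_le {μ : Measure ℝ} [IsProbabilityMeasure μ]
    (hμ : Integrable (fun u : ℝ => u) μ) (π : Policy) (ubar : ℝ) :
    ∫ u, π.payoffInspected ubar u ∂μ ≤ ubar + expectedGain μ ubar := by
  rw [← integral_max_eq hμ]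
  exact integral_mono (π.integrable_payoffInspected hμ ubar) ((integrable_const ubar).sup hμ)
    (π.payoffInspected_le ubar)

end Policy

/-! ### Index policies and optimality -/

open Classical in
/-- The Gittins index policy that resolves ties in favour of the product. -/
noncomputable def favoringPolicy (ubar z : ℝ) : Policy where
  choice
    | .uninspected => if z < ubar then .fallback else .inspect
    | .inspected u => if u < ubar then .fallback else .purchase u
  choice_mem
    | .uninspected => by by_cases h : z < ubar <;> simp [h, available]
    | .inspected u => by by_cases h : u < ubar <;> simp [h, available]
  measurableSet_purchase := by
    have h : {u : ℝ | (if u < ubar then Act.fallback else .purchase u) = .purchase u} =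
        Set.Ici ubar := by
      ext u
      simp
    exact h ▸ measurableSet_Ici

section FavoringPolicy

variable {ubar z : ℝ}

theorem favoringPolicy_of_lt (h : z < ubar) :
    (favoringPolicy ubar z).choice .uninspected = .fallback := by simp [favoringPolicy, h]

theorem favoringPolicy_of_le (h : ubar ≤ z) :
    (favoringPolicy ubar z).choice .uninspected = .inspect := by
  simp [favoringPolicy, h.not_gt]

theorem payoffInspected_favoringPolicy (u : ℝ) :
    (favoringPolicy ubar z).payoffInspected ubar u = max ubar u := by
  by_cases h : u < ubar
  · simp [favoringPolicy, Policy.payoffInspected, h, h.le]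
  · simp [favoringPolicy, Policy.payoffInspected, h, not_lt.1 h]

theorem favorsProduct_favoringPolicy : FavorsProduct ubar z (favoringPolicy ubar z) := by
  rintro (_ | u) hs a ha hne
  · rcases ha with rfl | rfl
    · exact absurd rfl hne
    · by_contra h
      have h' : ubar ≤ z := not_lt.1 h
      simp [favoringPolicy_of_le h'] at hs
  · rcases ha with rfl | rfl
    · exact absurd rfl hne
    · by_contra h
      have h' : ¬ u < ubar := h
      simp [favoringPolicy, h'] at hs

end FavoringPolicy

/-- After inspection each index is the payoff of its action, so the index rule means attaining the
maximum. The form matches `isOptimal_iff`, leaving only the first stage to compare. -/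
theorem isGittins_iff {ubar z : ℝ} {π : Policy} : IsGittins ubar z π ↔
    (π.choice .uninspected = .fallback → z ≤ ubar) ∧
    (π.choice .uninspected = .inspect → ubar ≤ z) ∧
    ∀ u, π.payoffInspected ubar u = max ubar u := by
  have hu : (∀ a ∈ available .uninspected,
      gittinsIndex ubar z a ≤ gittinsIndex ubar z (π.choice .uninspected)) ↔
      (π.choice .uninspected = .fallback → z ≤ ubar) ∧
      (π.choice .uninspected = .inspect → ubar ≤ z) := by
    rcases π.choice_uninspected with h | h <;> simp [h, available, gittinsIndex]
  have hi : ∀ u, (∀ a ∈ available (.inspected u),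
      gittinsIndex ubar z a ≤ gittinsIndex ubar z (π.choice (.inspected u))) ↔
      π.payoffInspected ubar u = max ubar u := by
    intro u
    rcases π.choice_inspected u with h | h
    · simp [Policy.payoffInspected_of_fallback h, h, available, gittinsIndex]
    · simp [Policy.payoffInspected_of_purchase h, h, available, gittinsIndex]
  rw [← and_assoc, ← hu]
  simp only [← hi]
  exact ⟨fun h => ⟨h _, fun u => h _⟩, fun h s => by cases s; exacts [h.1, h.2 _]⟩

theorem isOptimal_iff {μ : Measure ℝ} [IsProbabilityMeasure μ]
    (hμ : Integrable (fun u : ℝ => u) μ) {c ubar : ℝ} {π : Policy} : IsOptimal μ c ubar π ↔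
    (π.choice .uninspected = .fallback → expectedGain μ ubar ≤ c) ∧
    (π.choice .uninspected = .inspect → c ≤ expectedGain μ ubar) ∧
    ∀ u, π.payoffInspected ubar u = max ubar u := by
  have hval : ∀ π : Policy, π.choice .uninspected = .inspect →
      (∀ u, π.payoffInspected ubar u = max ubar u) →
      π.value μ c ubar .uninspected = -c + (ubar + expectedGain μ ubar) := by
    intro π h hmax
    simp only [Policy.value_uninspected_of_inspect h, hmax, integral_max_eq hμ]
  constructor
  · intro hopt
    -- Optimality at each inspected stage gives this for every u, not just a.e.
    have hmax : ∀ u, π.payoffInspected ubar u = max ubar u := fun u =>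
      (π.payoffInspected_le ubar u).antisymm <|
        payoffInspected_favoringPolicy (z := ubar) u ▸
          hopt (.inspected u) (favoringPolicy ubar ubar)
    refine ⟨fun h => ?_, fun h => ?_, hmax⟩
    -- The second parameter only steers the first action of the competitor: `ubar` makes it inspect,
    -- `ubar - 1` below makes it take the fallback.
    · have := hopt .uninspected (favoringPolicy ubar ubar)
      rw [Policy.value_uninspected_of_fallback h,
        hval _ (favoringPolicy_of_le le_rfl) payoffInspected_favoringPolicy] at this
      linarith
    · have := hopt .uninspected (favoringPolicy ubar (ubar - 1))
      rw [Policy.value_uninspected_of_fallback (favoringPolicy_of_lt (by linarith)),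
        hval _ h hmax] at this
      linarith
  · rintro ⟨hf, hi, hmax⟩ (_ | u) π'
    · have hint := π'.integral_payoffInspected_le hμ ubar
      rcases π.choice_uninspected with h | h <;> rcases π'.choice_uninspected with h' | h'
      · rw [Policy.value_uninspected_of_fallback h, Policy.value_uninspected_of_fallback h']
      · rw [Policy.value_uninspected_of_fallback h, Policy.value_uninspected_of_inspect h']
        linarith [hf h]
      · rw [hval π h hmax, Policy.value_uninspected_of_fallback h']
        linarith [hi h]
      · rw [hval π h hmax, Policy.value_uninspected_of_inspect h']
        linarith
    · exact (π'.payoffInspected_le ubar u).trans_eq (hmax u).symm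

theorem isOptimal_iff_isGittins {μ : Measure ℝ} [IsProbabilityMeasure μ]
    (hμ : Integrable (fun u : ℝ => u) μ) {c z ubar : ℝ} (hc : 0 < c)
    (hz : expectedGain μ z = c) {π : Policy} :
    IsOptimal μ c ubar π ↔ IsGittins ubar z π := by
  subst hz
  rw [isOptimal_iff hμ, isGittins_iff, expectedGain_le_iff hμ hc, le_expectedGain_iff hμ hc]

theorem isGittins_favoringPolicy {ubar z : ℝ} : IsGittins ubar z (favoringPolicy ubar z) := by
  refine isGittins_iff.2 ⟨fun h => ?_, fun h => ?_, payoffInspected_favoringPolicy⟩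
  · by_contra! hlt
    simp [favoringPolicy_of_le hlt.le] at h
  · by_contra! hlt
    simp [favoringPolicy_of_lt hlt] at h

/-! ### Selection of the fallback and the effective value -/

theorem IsGittins.selectsFallback_of_lt {ubar z u : ℝ} {π : Policy} (h : IsGittins ubar z π)
    (hlt : effectiveValue z u < ubar) : π.SelectsFallback u := by
  rw [Policy.selectsFallback_iff]
  obtain ⟨-, hi, hmax⟩ := isGittins_iff.1 h
  rcases min_lt_iff.1 hlt with hz | hu
  · exact .inl (π.choice_uninspected.resolve_right fun h' => (hi h').not_gt hz)
  · refine .inr ((π.choice_inspected u).resolve_right fun h' => ?_)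
    have := hmax u
    rw [Policy.payoffInspected_of_purchase h', max_eq_left hu.le] at this
    exact hu.ne this

theorem IsGittins.effectiveValue_le {ubar z u : ℝ} {π : Policy} (h : IsGittins ubar z π)
    (hsel : π.SelectsFallback u) : effectiveValue z u ≤ ubar := by
  obtain ⟨hf, -, hmax⟩ := isGittins_iff.1 h
  rcases (Policy.selectsFallback_iff u).1 hsel with h' | h'
  · exact (min_le_left _ _).trans (hf h')
  · have := hmax u
    rw [Policy.payoffInspected_of_fallback h'] at this
    exact (min_le_right _ _).trans (this ▸ le_max_right _ _)

/-- Wherever the fallback is taken, the tie rule makes it strictly beat z or u, hence their minimum.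
-/
theorem FavorsProduct.effectiveValue_lt {ubar z u : ℝ} {π : Policy} (h : FavorsProduct ubar z π)
    (hsel : π.SelectsFallback u) : effectiveValue z u < ubar := by
  rcases (Policy.selectsFallback_iff u).1 hsel with h' | h'
  · exact min_lt_of_left_lt (h _ h' .inspect (by simp [available]) (by simp))
  · exact min_lt_of_right_lt (h _ h' (.purchase u) (by simp [available]) (by simp))

end Search

theorem lemma2 (μ : Measure ℝ) [IsProbabilityMeasure μ] (hμ : Integrable (fun u : ℝ => u) μ)
    (c : ℝ) (hc : 0 < c) :
    ∃ z : ℝ, Search.IsReservationValue μ c z ∧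
      (∀ z' : ℝ, Search.IsReservationValue μ c z' → z' = z) ∧
      ∀ ubar : ℝ,
        -- the optimal policies are exactly the Gittins index policies
        (∀ π : Search.Policy, Search.IsOptimal μ c ubar π ↔ Search.IsGittins ubar z π) ∧
        -- under any of them, the fallback is selected iff it exceeds the effective value,
        -- ties being left open
        (∀ π : Search.Policy, Search.IsOptimal μ c ubar π →
          ∀ u : ℝ, ubar ≠ Search.effectiveValue z u →
            (π.SelectsFallback u ↔ ubar > Search.effectiveValue z u)) ∧
        -- and without exception if ties are resolved in favour of the product
        (∃ π : Search.Policy, Search.IsOptimal μ c ubar π ∧ Search.FavorsProduct ubar z π) ∧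
        (∀ π : Search.Policy, Search.IsOptimal μ c ubar π → Search.FavorsProduct ubar z π →
          ∀ u : ℝ, π.SelectsFallback u ↔ ubar > Search.effectiveValue z u) := by
  obtain ⟨z, hz⟩ := Search.exists_expectedGain_eq hμ hc
  have hpos : 0 < Search.expectedGain μ z := hz ▸ hc
  refine ⟨z, Search.isReservationValue_iff.2 hz, fun z' hz' => ?_, fun ubar => ?_⟩
  · have heq := (Search.isReservationValue_iff.1 hz').trans hz.symm
    exact ((Search.le_expectedGain_iff hμ hpos).1 heq.ge).antisymm
      ((Search.expectedGain_le_iff hμ hpos).1 heq.le)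
  · have hiff : ∀ π : Search.Policy, Search.IsOptimal μ c ubar π ↔ Search.IsGittins ubar z π :=
      fun π => Search.isOptimal_iff_isGittins hμ hc hz
    refine ⟨hiff, fun π hπ u hne => ?_, ?_, fun π hπ hfav u => ?_⟩
    · have hg := (hiff π).1 hπ
      exact ⟨fun h => (hg.effectiveValue_le h).lt_of_ne' hne, hg.selectsFallback_of_lt⟩
    · exact ⟨Search.favoringPolicy ubar z, (hiff _).2 Search.isGittins_favoringPolicy,
        Search.favorsProduct_favoringPolicy⟩
    · exact ⟨hfav.effectiveValue_lt, ((hiff π).1 hπ).selectsFallback_of_lt⟩
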